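/- All graphs are finite, simple and have at least one vertex; $d(v)$ is the degree of $v$ in $G$. A graph $G$ is *outer-1-planar* if it has a drawing in the plane with all vertices on the outer face in which there is at most one crossing on each edge; equivalently, $G$ can be drawn in a closed disc so that the vertices are distinct points of the boundary circle, every edge is a simple arc in the disc joining its two ends and passing through no other vertex, and each edge has at most one crossing, a crossing on an edge $e$ being a pair $(f,p)$ of an edge $f\ne e$ and a point $p$ interior to both $e$ and $f$. Every outer-1-planar graph $G$ contains one of the following: 1. a vertex of degree at most $1$; 2. two adjacent vertices of degree $2$; 3. a triangle incident with a vertex of degree $2$; 4. one of the following configurations, where in each of them the named vertices are pairwise distinct, and the listed edges are edges of $G$ (further edges of $G$ between the named vertices are allowed as far as the degrees permit): - $G_3$: edges $ux,uy,vx,vy$ with $d(u)=d(v)=2$ and $d(y)\le 7$; - $G_6$: edges $ux,uy,vx,vy,uv$ with $d(u)=d(v)=3$ and $d(y)\le 7$; - $G_7$: edges $xv,vu,uw,wy,xw,vy$ with $d(u)=2$, $d(v)=d(w)=3$ and $d(y)\le 7$; - $G_8$: edges $xv,vu,uw,wy,xu,vy$ with $d(u)=d(v)=3$ and $d(w)=2$;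 - $G_9$: edges $xu,uw,wv,vz,zy,xv,wy$ with $d(u)=d(z)=2$ and $d(v)=d(w)=3$; - $G_{10}$: edges $xv,vu,uz,zw,wy,xz,vy$ with $d(u)=d(w)=2$ and $d(v)=d(z)=3$; - $G_{11}$: edges $xz,zw,wu,uv,va,ay,xv,wy$ with $d(u)=d(z)=d(a)=2$ and $d(v)=d(w)=3$. -/

import Mathlib

/-- A drawing of `G` whose vertices all lie on the outer face, normalised so that the drawing
lies in the closed unit disc of the plane `ℂ` and the vertices are distinct points of the
boundary circle. Every edge is a simple arc in the disc (not necessarily straight) that joins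
its two ends and passes through no vertex in between. Edges may intersect one another. -/
structure OuterDrawing {V : Type*} (G : SimpleGraph V) where
  /-- the point that represents a vertex -/
  pos : V → ℂ
  pos_injective : Function.Injective pos
  norm_pos : ∀ v, ‖pos v‖ = 1
  /-- the arc that represents an edge -/
  arc : G.edgeSet → unitInterval → ℂ
  arc_continuous : ∀ e, Continuous (arc e)
  arc_injective : ∀ e, Function.Injective (arc e)
  arc_ends : ∀ e : G.edgeSet, Sym2.map pos (e : Sym2 V) = s(arc e 0, arc e 1)
  norm_arc_le : ∀ e t, ‖arc e t‖ ≤ 1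
  arc_ne_pos : ∀ e, ∀ t ∈ Set.Ioo (0 : unitInterval) 1, ∀ v, arc e t ≠ pos v

namespace OuterDrawing

/-- The arc of the edge `e` without its two ends. -/
def inner {V : Type*} {G : SimpleGraph V} (D : OuterDrawing G) (e : G.edgeSet) : Set ℂ :=
  D.arc e '' Set.Ioo (0 : unitInterval) 1

/-- The crossings on the edge `e`: the pairs `(f, p)` of another edge `f` and a point `p` that is
interior to both `e` and `f`. -/
def crossings {V : Type*} {G : SimpleGraph V} (D : OuterDrawing G) (e : G.edgeSet) :
    Set (G.edgeSet × ℂ) :=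
  {q | q.1 ≠ e ∧ q.2 ∈ D.inner e ∩ D.inner q.1}

end OuterDrawing

/-- `G` is outer-1-planar: it has a drawing with all vertices on the outer face in which there is
at most one crossing on each edge. -/
def IsOuterOnePlanar {V : Type*} (G : SimpleGraph V) : Prop :=
  ∃ D : OuterDrawing G, ∀ e, (D.crossings e).Subsingleton

/- The configurations. In each of them `x` and `y` are the hollow vertices: their degree in `G` is
at least their degree in the configuration, which is automatic for a subgraph; in `G₃`, `G₆` and
`G₇` the degree of `y` in `G` is moreover at most `7`. All other vertices are solid: their degree
in `G` equals their degree in the configuration. -/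

section Configurations

variable {V : Type*} [Fintype V] (G : SimpleGraph V) [DecidableRel G.Adj]

/-- The 4-cycle `x u y v` with `d(u) = d(v) = 2` and `d(y) ≤ 7`. -/
def ContainsG3 : Prop :=
  ∃ x y u v : V, [x, y, u, v].Nodup ∧
    G.Adj u x ∧ G.Adj u y ∧ G.Adj v x ∧ G.Adj v y ∧
    G.degree u = 2 ∧ G.degree v = 2 ∧ G.degree y ≤ 7

/-- The 4-cycle `x u y v` with the chord `uv`, `d(u) = d(v) = 3` and `d(y) ≤ 7`. -/
def ContainsG6 : Prop :=
  ∃ x y u v : V, [x, y, u, v].Nodup ∧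
    G.Adj u x ∧ G.Adj u y ∧ G.Adj v x ∧ G.Adj v y ∧ G.Adj u v ∧
    G.degree u = 3 ∧ G.degree v = 3 ∧ G.degree y ≤ 7

/-- The path `x v u w y` with the crossing chords `xw` and `vy`, where `d(u) = 2`,
`d(v) = d(w) = 3` and `d(y) ≤ 7`. -/
def ContainsG7 : Prop :=
  ∃ x y u v w : V, [x, y, u, v, w].Nodup ∧
    G.Adj x v ∧ G.Adj v u ∧ G.Adj u w ∧ G.Adj w y ∧ G.Adj x w ∧ G.Adj v y ∧
    G.degree u = 2 ∧ G.degree v = 3 ∧ G.degree w = 3 ∧ G.degree y ≤ 7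

/-- The path `x v u w y` with the crossing chords `xu` and `vy`, where `d(u) = d(v) = 3` and
`d(w) = 2`. -/
def ContainsG8 : Prop :=
  ∃ x y u v w : V, [x, y, u, v, w].Nodup ∧
    G.Adj x v ∧ G.Adj v u ∧ G.Adj u w ∧ G.Adj w y ∧ G.Adj x u ∧ G.Adj v y ∧
    G.degree u = 3 ∧ G.degree v = 3 ∧ G.degree w = 2

/-- The path `x u w v z y` with the crossing chords `xv` and `wy`, where `d(u) = d(z) = 2` and
`d(v) = d(w) = 3`. -/
def ContainsG9 : Prop :=
  ∃ x y u v w z : V, [x, y, u, v, w, z].Nodup ∧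
    G.Adj x u ∧ G.Adj u w ∧ G.Adj w v ∧ G.Adj v z ∧ G.Adj z y ∧ G.Adj x v ∧ G.Adj w y ∧
    G.degree u = 2 ∧ G.degree z = 2 ∧ G.degree v = 3 ∧ G.degree w = 3

/-- The path `x v u z w y` with the crossing chords `xz` and `vy`, where `d(u) = d(w) = 2` and
`d(v) = d(z) = 3`. -/
def ContainsG10 : Prop :=
  ∃ x y u v w z : V, [x, y, u, v, w, z].Nodup ∧
    G.Adj x v ∧ G.Adj v u ∧ G.Adj u z ∧ G.Adj z w ∧ G.Adj w y ∧ G.Adj x z ∧ G.Adj v y ∧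
    G.degree u = 2 ∧ G.degree w = 2 ∧ G.degree v = 3 ∧ G.degree z = 3

/-- The path `x z w u v a y` with the crossing chords `xv` and `wy`, where
`d(z) = d(u) = d(a) = 2` and `d(v) = d(w) = 3`. -/
def ContainsG11 : Prop :=
  ∃ x y u v w z a : V, [x, y, u, v, w, z, a].Nodup ∧
    G.Adj x z ∧ G.Adj z w ∧ G.Adj w u ∧ G.Adj u v ∧ G.Adj v a ∧ G.Adj a y ∧
    G.Adj x v ∧ G.Adj w y ∧
    G.degree u = 2 ∧ G.degree z = 2 ∧ G.degree a = 2 ∧ G.degree v = 3 ∧ G.degree w = 3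

end Configurations

/-! Arcs in a disc with interleaved ends on the circle must meet (`exists_eq_of_interleaved`), so a
drawing with at most one crossing per edge yields a linear order of the vertices in which each chord
is interleaved with at most one other. The rest is combinatorial. Assume that no listed
configuration occurs. By induction, every interval that no edge leaves from its interior is empty
inside, a path through one vertex of degree 2, or heavy: both ends have degree at least 8 but send
at most two edges each inside (`IsClosedInterval.isBasic`). A nonempty interval splits at an
uncovered vertex, or into three intervals under two crossing chords. The inner split vertices have
degree at most 7, so no piece is heavy, and the remaining combinations are basic or contain a
configuration. The whole vertex set is such an interval, yet its least vertex then has degree at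
most 1, or at most 3 in the heavy case. -/

/-! ### Planar topology: curves in the disc with interleaved ends -/

open Complex in
/-- A continuous logarithm of `c * h` differs from `log ∘ h` by a constant, if `h` avoids the
branch cut. -/
theorem continuousLog_sub_eq {L h : unitInterval → ℂ} (hL : Continuous L) (hh : Continuous h)
    (c : ℂ) (hs : ∀ t, h t ∈ slitPlane) (hexp : ∀ t, exp (L t) = c * h t) :
    L 1 - L 0 = log (h 1) - log (h 0) := by
  have hne : ∀ t, h t ≠ 0 := fun t => slitPlane_ne_zero (hs t)
  -- Both sides lift the same path along the covering `exp` and agree at 0.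
  have key : L = fun t => log (h t) + (L 0 - log (h 0)) := by
    refine isCoveringMap_exp.eq_of_comp_eq hL ((hh.clog hs).add continuous_const) ?_ 0 (by ring)
    funext t
    apply Subtype.ext
    change exp (L t) = exp (log (h t) + (L 0 - log (h 0)))
    rw [exp_add, exp_sub, exp_log (hne t), exp_log (hne 0), hexp, hexp]
    field_simp [hne 0]
  have h1 := congrFun key 1
  beta_reduce at h1
  linear_combination h1

/-- A continuous map without zeros on the unit square has a continuous logarithm. -/
theorem exists_continuousLog_square {f : unitInterval × unitInterval → ℂ} (hf : Continuous f)
    (h0 : ∀ p, f p ≠ 0) :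
    ∃ L : unitInterval × unitInterval → ℂ, Continuous L ∧ ∀ p, Complex.exp (L p) = f p := by
  -- Clamping both coordinates extends `f` to the simply connected plane, where it lifts along
  -- `exp`.
  let r : ℝ × ℝ → unitInterval × unitInterval := fun x =>
    (Set.projIcc 0 1 zero_le_one x.1, Set.projIcc 0 1 zero_le_one x.2)
  have hr : Continuous r := by fun_prop
  obtain ⟨F, ⟨-, hF⟩, -⟩ := Complex.isCoveringMapOn_exp.existsUnique_continuousMap_lifts
    (⟨f ∘ r, hf.comp hr⟩ : C(ℝ × ℝ, ℂ)) (a₀ := (0, 0))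
    (Complex.exp_log (h0 (r (0, 0)))) (fun p => h0 (r p))
  refine ⟨fun p => F (p.1, p.2), by fun_prop, fun p => ?_⟩
  refine (congrFun hF (p.1, p.2)).trans ?_
  change f (r (p.1, p.2)) = f p
  simp [r]

-- This follows from `1 - exp (iφ) = 2 sin (φ/2) exp (i(φ - π)/2)`, with a positive sine.
open Complex in
theorem arg_one_sub_exp_mul_I {φ : ℝ} (h0 : 0 < φ) (h1 : φ < 2 * Real.pi) :
    arg (1 - exp (φ * I)) = (φ - Real.pi) / 2 := by
  have hs : 0 < 2 * Real.sin (φ / 2) := by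
    have := Real.sin_pos_of_pos_of_lt_pi (x := φ / 2) (by linarith) (by linarith)
    linarith
  have : 1 - exp (φ * I) = ((2 * Real.sin (φ / 2) : ℝ) : ℂ) *
      (Complex.cos (((φ - Real.pi) / 2 : ℝ) : ℂ) + Complex.sin (((φ - Real.pi) / 2 : ℝ) : ℂ) * I) := by
    have e1 : (φ - Real.pi) / 2 = φ / 2 - Real.pi / 2 := by ring
    have e2 : φ = 2 * (φ / 2) := by ring
    rw [exp_mul_I, ← ofReal_cos, ← ofReal_sin, ← ofReal_cos, ← ofReal_sin, e1,
      Real.cos_sub_pi_div_two, Real.sin_sub_pi_div_two]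
    have c := Real.cos_two_mul (φ / 2)
    have s := Real.sin_two_mul (φ / 2)
    rw [← e2] at c s
    rw [c, s]
    have := Real.sin_sq_add_cos_sq (φ / 2)
    have hc : Real.cos (φ / 2) ^ 2 = 1 - Real.sin (φ / 2) ^ 2 := by linarith
    rw [hc]
    push_cast
    ring
  rw [this, arg_mul_cos_add_sin_mul_I hs]
  constructor <;> linarith

open Complex in
theorem arg_one_sub_exp_neg_mul_I {φ : ℝ} (h0 : -(2 * Real.pi) < φ) (h1 : φ < 0) :
    arg (1 - exp (φ * I)) = (φ + Real.pi) / 2 := by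
  have h := arg_one_sub_exp_mul_I (φ := -φ) (by linarith) (by linarith)
  have e : 1 - exp (φ * I) = (starRingEnd ℂ) (1 - exp ((-φ : ℝ) * I)) := by
    rw [map_sub, map_one, ← exp_conj, map_mul, conj_ofReal, conj_I]
    congr 2
    push_cast
    ring
  rw [e, arg_conj, h, if_neg]
  · ring
  · intro h; linarith

open Complex in
theorem one_sub_mem_slitPlane {z : ℂ} (hz : ‖z‖ ≤ 1) (h1 : z ≠ 1) : 1 - z ∈ slitPlane := by
  refine Or.inl ?_
  rw [sub_re, one_re, sub_pos]
  refine lt_of_le_of_ne ((re_le_norm z).trans hz) fun h => h1 ?_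
  have h2 : z.re ^ 2 + z.im ^ 2 ≤ 1 := by
    have h3 : ‖z‖ ^ 2 = z.re ^ 2 + z.im ^ 2 := by
      rw [← normSq_eq_norm_sq, normSq_apply]; ring
    rw [← h3]; exact pow_le_one₀ (norm_nonneg z) hz
  apply Complex.ext
  · exact h
  · rw [one_im]; nlinarith

open Complex in
/-- Two curves in the closed unit disc meet if their ends are interleaved on the circle. -/
theorem exists_eq_of_interleaved {p q : unitInterval → ℂ} (hp : Continuous p) (hq : Continuous q)
    (hp1 : ∀ t, ‖p t‖ ≤ 1) (hq1 : ∀ t, ‖q t‖ ≤ 1) {α β γ δ : ℝ}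
    (hαγ : α < γ) (hγβ : γ < β) (hβδ : β < δ) (hδα : δ < α + 2 * Real.pi)
    (hp0 : p 0 = exp (α * I)) (hpe : p 1 = exp (β * I))
    (hq0 : q 0 = exp (γ * I)) (hqe : q 1 = exp (δ * I)) : ∃ s t, p s = q t := by
  by_contra! hne
  -- If the curves are disjoint, `p s - q t` has a continuous logarithm on the square, so its
  -- argument has no net change around the boundary.
  obtain ⟨L, hL, hexp⟩ := exists_continuousLog_square
    (f := fun x => p x.1 - q x.2) (by fun_prop) (fun x => sub_ne_zero.2 (hne x.1 x.2))
  have rot : ∀ θ : ℝ, exp (θ * I) * exp ((-θ : ℝ) * I) = 1 := fun θ => by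
    rw [← exp_add]; simp
  have nrm : ∀ (θ : ℝ) (z : ℂ), ‖z‖ ≤ 1 → ‖exp ((-θ : ℝ) * I) * z‖ ≤ 1 := fun θ z hz => by
    rwa [norm_mul, norm_exp_ofReal_mul_I, one_mul]
  have slit : ∀ (θ : ℝ) (z : ℂ), ‖z‖ ≤ 1 → z ≠ exp (θ * I) →
      1 - exp ((-θ : ℝ) * I) * z ∈ slitPlane := fun θ z hz h =>
    one_sub_mem_slitPlane (nrm θ z hz) fun h1 => h <| by
      calc z = exp (θ * I) * exp ((-θ : ℝ) * I) * z := by rw [rot, one_mul]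
        _ = _ := by rw [mul_assoc, h1, mul_one]
  -- On a side of the square one curve rests at a point `exp (iθ)` of the circle. Rotated by `-θ`,
  -- the difference stays in the right half plane, so principal arguments give the change.
  have side : ∀ (θ : ℝ) (r : unitInterval → ℂ) (M : unitInterval → ℂ) (c : ℂ) (φ ψ : ℝ),
      Continuous r → Continuous M → (∀ t, ‖r t‖ ≤ 1) → (∀ t, r t ≠ exp (θ * I)) →
      (∀ t, exp (M t) = c * (exp (θ * I) - r t)) → r 0 = exp (φ * I) → r 1 = exp (ψ * I) →
      (M 1).im - (M 0).im =
        arg (1 - exp ((ψ - θ : ℝ) * I)) - arg (1 - exp ((φ - θ : ℝ) * I)) := by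
    intro θ r M c φ ψ hr hM hr1 hrne hMe h0 h1
    have := continuousLog_sub_eq (L := M) (h := fun t => 1 - exp ((-θ : ℝ) * I) * r t) hM
      (by fun_prop) (c * exp (θ * I)) (fun t => slit θ _ (hr1 t) (hrne t)) (fun t => by
        rw [hMe]
        linear_combination (c * r t) * rot θ)
    have h2 := congrArg Complex.im this
    simp only [sub_im, log_im, h0, h1, ← exp_add, ← add_mul, ← ofReal_add] at h2
    rw [h2, neg_add_eq_sub, neg_add_eq_sub]
  have s1 := side α q (fun t => L (0, t)) 1 γ δ hq (by fun_prop) hq1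
    (fun t => hp0 ▸ (hne 0 t).symm) (fun t => by rw [hexp, ← hp0, one_mul]) hq0 hqe
  have s2 := side β q (fun t => L (1, t)) 1 γ δ hq (by fun_prop) hq1
    (fun t => hpe ▸ (hne 1 t).symm) (fun t => by rw [hexp, ← hpe, one_mul]) hq0 hqe
  have s3 := side γ p (fun t => L (t, 0)) (-1) α β hp (by fun_prop) hp1
    (fun t => hq0 ▸ hne t 0) (fun t => by rw [hexp, ← hq0]; ring) hp0 hpe
  have s4 := side δ p (fun t => L (t, 1)) (-1) α β hp (by fun_prop) hp1
    (fun t => hqe ▸ hne t 1) (fun t => by rw [hexp, ← hqe]; ring) hp0 hpe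
  rw [arg_one_sub_exp_mul_I (by linarith) (by linarith),
    arg_one_sub_exp_mul_I (by linarith) (by linarith)] at s1
  rw [arg_one_sub_exp_mul_I (by linarith) (by linarith),
    arg_one_sub_exp_neg_mul_I (by linarith) (by linarith)] at s2
  rw [arg_one_sub_exp_mul_I (by linarith) (by linarith),
    arg_one_sub_exp_neg_mul_I (by linarith) (by linarith)] at s3
  rw [arg_one_sub_exp_neg_mul_I (by linarith) (by linarith),
    arg_one_sub_exp_neg_mul_I (by linarith) (by linarith)] at s4
  -- The change from corner (0,0) to (1,1) is `(β - α + δ - γ)/2` along one pair of sides and `2π`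
  -- less along the other.
  linarith [Real.pi_pos]

/-! ### From drawings to a linear order -/

namespace OuterDrawing

variable {V : Type*} {G : SimpleGraph V} (D : OuterDrawing G)

theorem exists_oriented_arc {a b : V} (h : G.Adj a b) :
    ∃ p : unitInterval → ℂ, Continuous p ∧ (∀ t, ∃ s, p t = D.arc ⟨s(a, b), h⟩ s) ∧
      p 0 = D.pos a ∧ p 1 = D.pos b := by
  have he := D.arc_ends ⟨s(a, b), h⟩
  rw [Sym2.map_mk, Sym2.eq_iff] at he
  rcases he with ⟨h0, h1⟩ | ⟨h0, h1⟩
  · exact ⟨_, D.arc_continuous _, fun t => ⟨t, rfl⟩, h0.symm, h1.symm⟩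
  · refine ⟨fun t => D.arc ⟨s(a, b), h⟩ (unitInterval.symm t),
      (D.arc_continuous _).comp unitInterval.continuous_symm, fun t => ⟨_, rfl⟩, ?_, ?_⟩
    · simp [h0]
    · simp [h1]

theorem arc_mem_inner_or_eq_pos {a b : V} (h : G.Adj a b) (t : unitInterval) :
    t ∈ Set.Ioo (0 : unitInterval) 1 ∨ D.arc ⟨s(a, b), h⟩ t = D.pos a ∨
      D.arc ⟨s(a, b), h⟩ t = D.pos b := by
  have he := D.arc_ends ⟨s(a, b), h⟩
  rw [Sym2.map_mk, Sym2.eq_iff] at he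
  rcases eq_or_lt_of_le (unitInterval.nonneg' (t := t)) with rfl | h0
  · rcases he with ⟨h0, h1⟩ | ⟨h0, h1⟩ <;> simp [h0, h1]
  rcases eq_or_lt_of_le (unitInterval.le_one' (t := t)) with rfl | h1
  · rcases he with ⟨h0, h1⟩ | ⟨h0, h1⟩ <;> simp [h0, h1]
  exact Or.inl ⟨h0, h1⟩

theorem arg_pos_injective : Function.Injective fun v => Complex.arg (D.pos v) := fun v w h =>
  D.pos_injective (Complex.ext_norm_arg (by rw [D.norm_pos, D.norm_pos]) h)

theorem exists_mem_inner_of_interleaved {a b c d : V} (hab : G.Adj a b) (hcd : G.Adj c d)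
    (h1 : (D.pos a).arg < (D.pos c).arg) (h2 : (D.pos c).arg < (D.pos b).arg)
    (h3 : (D.pos b).arg < (D.pos d).arg) :
    ∃ z, z ∈ D.inner ⟨s(a, b), hab⟩ ∧ z ∈ D.inner ⟨s(c, d), hcd⟩ := by
  have hac : a ≠ c := by rintro rfl; exact h1.false
  have hbc : b ≠ c := by rintro rfl; exact h2.false
  have hbd : b ≠ d := by rintro rfl; exact h3.false
  have had : a ≠ d := by rintro rfl; exact (h1.trans (h2.trans h3)).false
  have hpos : ∀ v, D.pos v = Complex.exp ((D.pos v).arg * Complex.I) := fun v => by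
    have := Complex.norm_mul_exp_arg_mul_I (D.pos v)
    rw [D.norm_pos, Complex.ofReal_one, one_mul] at this
    exact this.symm
  obtain ⟨p, hp, hpe, hp0, hp1⟩ := D.exists_oriented_arc hab
  obtain ⟨q, hq, hqf, hq0, hq1⟩ := D.exists_oriented_arc hcd
  obtain ⟨s, t, hst⟩ := exists_eq_of_interleaved hp hq
    (fun t => by obtain ⟨s, hs⟩ := hpe t; rw [hs]; exact D.norm_arc_le _ _)
    (fun t => by obtain ⟨s, hs⟩ := hqf t; rw [hs]; exact D.norm_arc_le _ _) h1 h2 h3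
    (by linarith [Complex.arg_le_pi (D.pos d), Complex.neg_pi_lt_arg (D.pos a)])
    (hp0.trans (hpos a)) (hp1.trans (hpos b)) (hq0.trans (hpos c)) (hq1.trans (hpos d))
  obtain ⟨s', hs'⟩ := hpe s
  obtain ⟨t', ht'⟩ := hqf t
  rw [hs', ht'] at hst
  -- Otherwise `a` or `b` lies on the arc of `cd`, which meets no vertices except `c` and `d`.
  have hs : s' ∈ Set.Ioo (0 : unitInterval) 1 := by
    by_contra hs
    have hv : ∃ v, (v = a ∨ v = b) ∧ D.arc ⟨s(a, b), hab⟩ s' = D.pos v := by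
      rcases D.arc_mem_inner_or_eq_pos hab s' with h | h | h
      exacts [absurd h hs, ⟨a, Or.inl rfl, h⟩, ⟨b, Or.inr rfl, h⟩]
    obtain ⟨v, hv, hvs⟩ := hv
    rw [hst] at hvs
    rcases D.arc_mem_inner_or_eq_pos hcd t' with h | h | h
    · exact D.arc_ne_pos _ _ h v hvs
    · have := D.pos_injective (h.symm.trans hvs)
      rcases hv with rfl | rfl
      exacts [hac this.symm, hbc this.symm]
    · have := D.pos_injective (h.symm.trans hvs)
      rcases hv with rfl | rfl
      exacts [had this.symm, hbd this.symm]
  have ht : t' ∈ Set.Ioo (0 : unitInterval) 1 := by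
    rcases D.arc_mem_inner_or_eq_pos hcd t' with h | h | h
    · exact h
    · exact absurd (hst.trans h) (D.arc_ne_pos _ _ hs c)
    · exact absurd (hst.trans h) (D.arc_ne_pos _ _ hs d)
  exact ⟨_, ⟨s', hs, rfl⟩, ⟨t', ht, hst.symm⟩⟩

end OuterDrawing

/-- For vertices placed in convex position in the given linear order: every chord is crossed by
at most one other chord. -/
def AtMostOneCrossing {V : Type*} [LinearOrder V] (G : SimpleGraph V) : Prop :=
  ∀ ⦃a b c d c' d' : V⦄, G.Adj a b → G.Adj c d → G.Adj c' d' → a < c → c < b → (d < a ∨ b < d) →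
    a < c' → c' < b → (d' < a ∨ b < d') → c = c' ∧ d = d'

/-- Cutting the circle at -1 orders the vertices by argument. Interleaved edges cross in the
drawing, so two interleavings on one edge would be two crossings. -/
theorem IsOuterOnePlanar.exists_linearOrder {V : Type*} {G : SimpleGraph V}
    (hG : IsOuterOnePlanar G) : ∃ _ : LinearOrder V, AtMostOneCrossing G := by
  obtain ⟨D, hD⟩ := hG
  let _ : LinearOrder V := LinearOrder.lift' _ D.arg_pos_injective
  refine ⟨inferInstance, ?_⟩
  have cross : ∀ a b c d : V, ∀ (hab : G.Adj a b) (hcd : G.Adj c d), a < c → c < b →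
      (d < a ∨ b < d) → ∃ z, ((⟨s(c, d), hcd⟩ : G.edgeSet), z) ∈ D.crossings ⟨s(a, b), hab⟩ := by
    intro a b c d hab hcd h1 h2 h3
    have hne : (⟨s(c, d), hcd⟩ : G.edgeSet) ≠ ⟨s(a, b), hab⟩ := by
      intro h
      have h := congrArg Subtype.val h
      rw [Sym2.eq_iff] at h
      rcases h with ⟨rfl, -⟩ | ⟨rfl, -⟩
      exacts [h1.false, h2.false]
    rcases h3 with h3 | h3
    · obtain ⟨z, hz1, hz2⟩ := D.exists_mem_inner_of_interleaved hcd.symm hab h3 h1 h2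
      have e : (⟨s(d, c), hcd.symm⟩ : G.edgeSet) = ⟨s(c, d), hcd⟩ := Subtype.ext Sym2.eq_swap
      rw [e] at hz1
      exact ⟨z, hne, hz2, hz1⟩
    · obtain ⟨z, hz1, hz2⟩ := D.exists_mem_inner_of_interleaved hab hcd h1 h2 h3
      exact ⟨z, hne, hz1, hz2⟩
  intro a b c d c' d' hab hcd hcd' h1 h2 h3 h1' h2' h3'
  obtain ⟨z, hz⟩ := cross a b c d hab hcd h1 h2 h3
  obtain ⟨z', hz'⟩ := cross a b c' d' hab hcd' h1' h2' h3'
  have h := congrArg (Subtype.val ∘ Prod.fst) (hD _ hz hz')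
  simp only [Function.comp_apply] at h
  rw [Sym2.eq_iff] at h
  rcases h with h | ⟨rfl, rfl⟩
  · exact h
  · rcases h3 with h3 | h3
    · exact absurd (h1'.trans h3) (lt_irrefl _)
    · exact absurd (h2'.trans h3) (lt_irrefl _)

/-! ### Degree counting without the configurations -/

section Avoids

variable {V : Type*} [Fintype V] (G : SimpleGraph V) [DecidableRel G.Adj]

/-- `G` contains none of the unavoidable configurations. -/
structure Avoids : Prop where
  two_le_degree : ∀ v, 2 ≤ G.degree v
  not_two_two : ∀ u v, G.Adj u v → G.degree u = 2 → G.degree v ≠ 2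
  not_triangle : ∀ u x y, G.Adj u x → G.Adj u y → G.Adj x y → G.degree u ≠ 2
  not_G3 : ¬ContainsG3 G
  not_G6 : ¬ContainsG6 G
  not_G7 : ¬ContainsG7 G
  not_G8 : ¬ContainsG8 G
  not_G9 : ¬ContainsG9 G
  not_G10 : ¬ContainsG10 G
  not_G11 : ¬ContainsG11 G

variable {G}

theorem degree_le_length {v : V} (l : List V) (h : ∀ w, G.Adj v w → w ∈ l) :
    G.degree v ≤ l.length := by
  classical
  rw [← G.card_neighborFinset_eq_degree]
  refine (Finset.card_le_card (t := l.toFinset) fun w hw => ?_).trans (List.toFinset_card_le l)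
  rw [SimpleGraph.mem_neighborFinset] at hw
  exact List.mem_toFinset.2 (h w hw)

/-- The neighbours are too many to omit an entry of `l`. Thus a list of candidates and a lower bound
on the degree together produce edges. -/
theorem adj_and_degree_of_length_le {v : V} (l : List V) (h : ∀ w, G.Adj v w → w ∈ l)
    (hl : l.length ≤ G.degree v) : (∀ w ∈ l, G.Adj v w) ∧ G.degree v = l.length := by
  classical
  have hs : G.neighborFinset v ⊆ l.toFinset := fun w hw => by
    rw [SimpleGraph.mem_neighborFinset] at hw
    exact List.mem_toFinset.2 (h w hw)
  refine ⟨fun w hw => ?_, (degree_le_length l h).antisymm hl⟩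
  rw [← SimpleGraph.mem_neighborFinset, Finset.eq_of_subset_of_card_le hs]
  · exact List.mem_toFinset.2 hw
  · rw [G.card_neighborFinset_eq_degree]
    exact (List.toFinset_card_le l).trans hl

namespace Avoids

variable (hG : Avoids G)
include hG

theorem adj_of_two {v x y : V} (h : ∀ w, G.Adj v w → w = x ∨ w = y) :
    G.Adj v x ∧ G.Adj v y ∧ G.degree v = 2 := by
  obtain ⟨h1, h2⟩ := adj_and_degree_of_length_le [x, y] (by simpa using h) (hG.two_le_degree v)
  exact ⟨h1 x (by simp), h1 y (by simp), h2⟩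

theorem adj_of_three {v x y z : V} (h : ∀ w, G.Adj v w → w = x ∨ w = y ∨ w = z)
    (hv : G.degree v ≠ 2) : G.Adj v x ∧ G.Adj v y ∧ G.Adj v z ∧ G.degree v = 3 := by
  obtain ⟨h1, h2⟩ := adj_and_degree_of_length_le [x, y, z] (by simpa using h)
    ((hG.two_le_degree v).lt_of_ne' hv)
  exact ⟨h1 x (by simp), h1 y (by simp), h1 z (by simp), h2⟩

end Avoids

end Avoids

/-! ### Closed intervals and how they split -/

section Intervals

variable {V : Type*} [LinearOrder V] (G : SimpleGraph V)

/-- No edge leads from the interior of `[a, b]` out of `[a, b]`. -/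
def IsClosedInterval (a b : V) : Prop :=
  ∀ ⦃v w⦄, a < v → v < b → G.Adj v w → a ≤ w ∧ w ≤ b

/-- At most two neighbours of `v` lie strictly between `a` and `b`. -/
def AtMostTwoBetween (v a b : V) : Prop :=
  ∃ p q, ∀ w, a < w → w < b → G.Adj v w → w = p ∨ w = q

variable [Fintype V] [DecidableRel G.Adj]

/-- The interior of `[a, b]` is a single vertex of degree two, and `a` and `b` are not adjacent. -/
structure IsTwoPath (a u b : V) : Prop where
  lt_left : a < u
  lt_right : u < b
  eq_of_mem : ∀ v, a < v → v < b → v = u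
  adj_left : G.Adj u a
  adj_right : G.Adj u b
  not_adj : ¬G.Adj a b
  degree_eq : G.degree u = 2

/-- Both ends of `[a, b]` have large degree, but send at most two edges each into the interior. -/
structure IsHeavy (a b : V) : Prop where
  left_degree : 7 < G.degree a
  right_degree : 7 < G.degree b
  left_two : AtMostTwoBetween G a a b
  right_two : AtMostTwoBetween G b a b

/-- The kinds of closed intervals that occur in a graph without unavoidable configurations. -/
def IsBasic (a b : V) : Prop :=
  (∀ v, a < v → v < b → False) ∨ (∃ u, IsTwoPath G a u b) ∨ IsHeavy G a b

variable {G} {a b : V}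

theorem IsBasic.atMostTwoBetween (h : IsBasic G a b) :
    AtMostTwoBetween G a a b ∧ AtMostTwoBetween G b a b := by
  rcases h with h | ⟨u, h⟩ | h
  · exact ⟨⟨a, a, fun w h1 h2 _ => (h w h1 h2).elim⟩, ⟨a, a, fun w h1 h2 _ => (h w h1 h2).elim⟩⟩
  · exact ⟨⟨u, u, fun w h1 h2 _ => Or.inl (h.eq_of_mem w h1 h2)⟩,
      ⟨u, u, fun w h1 h2 _ => Or.inl (h.eq_of_mem w h1 h2)⟩⟩
  · exact ⟨h.left_two, h.right_two⟩

omit [Fintype V] [DecidableRel G.Adj] in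
/-- A point of `[a, b]` is below no chord but `ab`, or `[a, b]` is spanned by two crossing
chords. -/
theorem AtMostOneCrossing.uncovered_or_crossing [Finite V] (hcr : AtMostOneCrossing G)
    (hne : ∃ v, a < v ∧ v < b) :
    (∃ p, a < p ∧ p < b ∧ ∀ v w, G.Adj v w → a ≤ v → v < p → p < w → w ≤ b → v = a ∧ w = b) ∨
      ∃ j k, a < j ∧ j < k ∧ k < b ∧ G.Adj a k ∧ G.Adj j b := by
  by_cases hk : ∃ k, a < k ∧ k < b ∧ G.Adj a k
  -- `k` is the farthest neighbour of `a` inside; it is the uncovered point unless some chord `jl`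
  -- other than `ab` passes over it.
  · obtain ⟨k, ⟨hak, hkb, hadj⟩, hmax⟩ :=
      Set.Finite.exists_maximal (s := {k | a < k ∧ k < b ∧ G.Adj a k}) (Set.toFinite _) hk
    have hmax' : ∀ w, G.Adj a w → w < b → w ≤ k := fun w hw hwb => by
      by_contra! hkw
      exact absurd (hmax ⟨hak.trans hkw, hwb, hw⟩ hkw.le) (not_le.2 hkw)
    by_cases hcov : ∃ j l, G.Adj j l ∧ a ≤ j ∧ j < k ∧ k < l ∧ l ≤ b ∧ ¬(j = a ∧ l = b)
    · obtain ⟨j, l, hjl, haj, hjk, hkl, hlb, hn⟩ := hcov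
      have haj : a < j := haj.lt_of_ne fun h => by
        subst h
        exact absurd (hmax' l hjl (hlb.lt_of_ne fun h => hn ⟨rfl, h⟩)) (not_le.2 hkl)
      rcases hlb.eq_or_lt with rfl | hlb
      · exact Or.inr ⟨j, k, haj, hjk, hkb, hadj, hjl⟩
      -- `ak` and `jl` cross each other. A chord over `l` that does not start at `a` would be a
      -- second crossing on `ak` (if it starts before `k`) or on `jl`.
      refine Or.inl ⟨l, hak.trans hkl, hlb, fun i m him hai hil hlm hmb => ?_⟩
      rcases hai.eq_or_lt with rfl | hai
      · refine ⟨rfl, hmb.antisymm (not_lt.1 fun h => ?_)⟩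
        exact absurd (hmax' m him h) (not_le.2 (hkl.trans hlm))
      exfalso
      rcases lt_or_ge i k with hik | hki
      · have := hcr hadj hjl him haj hjk (Or.inr hkl) hai hik (Or.inr (hkl.trans hlm))
        exact hlm.ne this.2
      · have := hcr hjl hadj.symm him hjk hkl (Or.inl haj) (hjk.trans_le hki) hil (Or.inr hlm)
        exact (hak.trans (hkl.trans hlm)).ne this.2
    · refine Or.inl ⟨k, hak, hkb, fun v w hvw h1 h2 h3 h4 => ?_⟩
      by_contra hn
      exact hcov ⟨v, w, hvw, h1, h2, h3, h4, hn⟩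
  · obtain ⟨p, ⟨hap, hpb⟩, hmin⟩ :=
      Set.Finite.exists_minimal (s := {p | a < p ∧ p < b}) (Set.toFinite _) hne
    refine Or.inl ⟨p, hap, hpb, fun v w hvw h1 h2 h3 h4 => ?_⟩
    have hva : v = a := by
      by_contra hva
      exact absurd (hmin ⟨h1.lt_of_ne' hva, h2.trans hpb⟩ h2.le) (not_le.2 h2)
    subst hva
    refine ⟨rfl, h4.antisymm (not_lt.1 fun h => hk ⟨w, hap.trans h3, h, hvw⟩)⟩

omit [Fintype V] [DecidableRel G.Adj] in
theorem IsClosedInterval.of_uncovered (hcl : IsClosedInterval G a b) {p : V} (hap : a < p)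
    (hpb : p < b)
    (hp : ∀ v w, G.Adj v w → a ≤ v → v < p → p < w → w ≤ b → v = a ∧ w = b) :
    IsClosedInterval G a p ∧ IsClosedInterval G p b := by
  constructor
  · intro v w h1 h2 hvw
    obtain ⟨h3, h4⟩ := hcl h1 (h2.trans hpb) hvw
    refine ⟨h3, not_lt.1 fun h => ?_⟩
    exact h1.ne' (hp v w hvw h1.le h2 h h4).1
  · intro v w h1 h2 hvw
    obtain ⟨h3, h4⟩ := hcl (hap.trans h1) h2 hvw
    refine ⟨not_lt.1 fun h => ?_, h4⟩
    exact h2.ne (hp w v hvw.symm h3 h h1 h2.le).2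

-- `ak` and `jb` have used up their crossing on each other, and an edge leaving the interior of a
-- piece would cross one of them again.
omit [Fintype V] [DecidableRel G.Adj] in
theorem IsClosedInterval.of_crossing (hcl : IsClosedInterval G a b) (hcr : AtMostOneCrossing G)
    {j k : V} (haj : a < j) (hjk : j < k) (hkb : k < b) (hak : G.Adj a k) (hjb : G.Adj j b) :
    IsClosedInterval G a j ∧ IsClosedInterval G j k ∧ IsClosedInterval G k b := by
  refine ⟨fun v w h1 h2 hvw => ?_, fun v w h1 h2 hvw => ?_, fun v w h1 h2 hvw => ?_⟩
  · obtain ⟨h3, h4⟩ := hcl h1 (h2.trans (hjk.trans hkb)) hvw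
    refine ⟨h3, not_lt.1 fun h => ?_⟩
    rcases h4.eq_or_lt with rfl | h4
    · exact h2.ne' (hcr hak hjb hvw haj hjk (Or.inr hkb) h1 (h2.trans hjk) (Or.inr hkb)).1
    · exact h1.ne (hcr hjb hak.symm hvw.symm hjk hkb (Or.inl haj) h h4 (Or.inl h2)).2
  · obtain ⟨h3, h4⟩ := hcl (haj.trans h1) (h2.trans hkb) hvw
    refine ⟨not_lt.1 fun h => ?_, not_lt.1 fun h => ?_⟩
    · exact h2.ne' (hcr hjb hak.symm hvw hjk hkb (Or.inl haj) h1 (h2.trans hkb) (Or.inl h)).1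
    · exact h1.ne (hcr hak hjb hvw haj hjk (Or.inr hkb) (haj.trans h1) h2 (Or.inr h)).1
  · obtain ⟨h3, h4⟩ := hcl (haj.trans (hjk.trans h1)) h2 hvw
    refine ⟨not_lt.1 fun h => ?_, h4⟩
    rcases h3.eq_or_lt with rfl | h3
    · exact h1.ne (hcr hjb hak.symm hvw hjk hkb (Or.inl haj) (hjk.trans h1) h2 (Or.inl haj)).1
    · exact h2.ne' (hcr hak hjb hvw.symm haj hjk (Or.inr hkb) h3 h (Or.inr h1)).2

end Intervals

/-! ### Induction over closed intervals -/

section Structure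

variable {V : Type*} [LinearOrder V] [Fintype V] {G : SimpleGraph V} [DecidableRel G.Adj]
  {a b j k : V}

/-- Neither part is heavy, since `p` has degree at most 6. A part that is a path would leave `p`
with degree 2 next to another vertex of degree 2, so both parts are empty and `[a, b]` is a path. -/
theorem IsClosedInterval.isBasic_of_uncovered (hG : Avoids G) (hcl : IsClosedInterval G a b) {p : V}
    (hap : a < p) (hpb : p < b) (h1 : IsBasic G a p) (h2 : IsBasic G p b) : IsBasic G a b := by
  have hnb : ∀ w, G.Adj p w → w = a ∨ (a < w ∧ w < p) ∨ (p < w ∧ w < b) ∨ w = b := fun w hw => by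
    obtain ⟨h3, h4⟩ := hcl hap hpb hw
    have := hw.ne
    grind
  have hdeg : ¬7 < G.degree p := by
    obtain ⟨q, r, hqr⟩ := h1.atMostTwoBetween.2
    obtain ⟨q', r', hqr'⟩ := h2.atMostTwoBetween.1
    have := degree_le_length [a, q, r, q', r', b] (fun w hw => by
      rcases hnb w hw with h | ⟨h, h'⟩ | ⟨h, h'⟩ | h
      · simp [h]
      · rcases hqr w h h' hw with h | h <;> simp [h]
      · rcases hqr' w h h' hw with h | h <;> simp [h]
      · simp [h])
    simp only [List.length_cons, List.length_nil] at this
    omega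
  rcases h1 with h1 | ⟨u, h1⟩ | h1
  · rcases h2 with h2 | ⟨u, h2⟩ | h2
    · obtain ⟨e1, e2, e3⟩ := hG.adj_of_two (v := p) (x := a) (y := b) (fun w hw => by
        have := hnb w hw
        grind)
      exact Or.inr (Or.inl ⟨p, hap, hpb, fun v hv hv' => by grind, e1, e2,
        fun h => hG.not_triangle p a b e1 e2 h e3, e3⟩)
    · obtain ⟨-, -, e3⟩ := hG.adj_of_two (v := p) (x := a) (y := u) (fun w hw => by
        have := hnb w hw
        have := h2.eq_of_mem w
        have := h2.not_adj
        grind)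
      exact absurd h2.degree_eq (hG.not_two_two p u h2.adj_left.symm e3)
    · exact absurd h2.left_degree hdeg
  · obtain ⟨e1, -, e3⟩ : G.Adj p u ∧ True ∧ G.degree p = 2 := by
      rcases h2 with h2 | ⟨u', h2⟩ | h2
      · obtain ⟨e1, -, e3⟩ := hG.adj_of_two (v := p) (x := u) (y := b) (fun w hw => by
          have := hnb w hw
          have := h1.eq_of_mem w
          have := h1.not_adj
          have := hw.symm
          grind)
        exact ⟨e1, trivial, e3⟩
      · obtain ⟨e1, -, e3⟩ := hG.adj_of_two (v := p) (x := u) (y := u') (fun w hw => by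
          have := hnb w hw
          have := h1.eq_of_mem w
          have := h1.not_adj
          have := h2.eq_of_mem w
          have := h2.not_adj
          have := hw.symm
          grind)
        exact ⟨e1, trivial, e3⟩
      · exact absurd h2.left_degree hdeg
    exact absurd h1.degree_eq (hG.not_two_two p u e1 e3)
  · exact absurd h1.right_degree hdeg

/-- An interval spanned by two crossing chords with nothing below them. -/
theorem isHeavy_of_crossing_of_empty (hG : Avoids G) (haj : a < j) (hjk : j < k) (hkb : k < b)
    (hak : G.Adj a k) (hjb : G.Adj j b) (hj : ∀ w, G.Adj j w → w = a ∨ w = k ∨ w = b)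
    (hk : ∀ w, G.Adj k w → w = a ∨ w = j ∨ w = b)
    (hin : ∀ w, a < w → w < b → w = j ∨ w = k) : IsHeavy G a b := by
  suffices h : 7 < G.degree a ∧ 7 < G.degree b from
    ⟨h.1, h.2, ⟨j, k, fun w h1 h2 _ => hin w h1 h2⟩, ⟨j, k, fun w h1 h2 _ => hin w h1 h2⟩⟩
  -- If `jk` is an edge, both inner degrees are 3 and $G_6$ applies; otherwise both are 2 and $G_3$
  -- applies. Either is used with `a` and with `b` as the vertex of bounded degree.
  by_cases ejk : G.Adj j k
  · by_cases dk : G.degree k = 2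
    · exfalso
      by_cases dj : G.degree j = 2
      · exact hG.not_two_two j k ejk dj dk
      obtain ⟨eja, -, -, -⟩ := hG.adj_of_three hj dj
      exact hG.not_triangle k j a ejk.symm hak.symm eja dk
    obtain ⟨-, -, ekb, dk⟩ := hG.adj_of_three hk dk
    by_cases dj : G.degree j = 2
    · exact absurd dj (hG.not_triangle j k b ejk hjb ekb)
    obtain ⟨eja, -, -, dj⟩ := hG.adj_of_three hj dj
    constructor
    · by_contra! h
      exact hG.not_G6 ⟨b, a, j, k, by grind, hjb, eja, ekb, hak.symm, ejk, dj, dk, h⟩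
    · by_contra! h
      exact hG.not_G6 ⟨a, b, j, k, by grind, eja, hjb, hak.symm, ekb, ejk, dj, dk, h⟩
  · obtain ⟨eja, -, dj⟩ := hG.adj_of_two (v := j) (x := a) (y := b) (by grind)
    obtain ⟨-, ekb, dk⟩ := hG.adj_of_two (v := k) (x := a) (y := b) fun w hw => by
      have := hk w hw
      have := hw.symm
      grind
    constructor
    · by_contra! h
      exact hG.not_G3 ⟨b, a, j, k, by grind, hjb, eja, ekb, hak.symm, dj, dk, h⟩
    · by_contra! h
      exact hG.not_G3 ⟨a, b, j, k, by grind, eja, hjb, hak.symm, ekb, dj, dk, h⟩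

/-- Being next to `u`, both `j` and `k` have degree 3, so avoiding $G_7$ in both orientations makes
the ends large. The third inner vertex `u` sees neither end. -/
theorem isHeavy_of_crossing_of_path_middle (hG : Avoids G) (haj : a < j) (hkb : k < b)
    (hak : G.Adj a k) (hjb : G.Adj j b) {u : V} (hu : IsTwoPath G j u k)
    (hj : ∀ w, G.Adj j w → w = a ∨ w = u ∨ w = b)
    (hk : ∀ w, G.Adj k w → w = a ∨ w = u ∨ w = b)
    (hin : ∀ w, a < w → w < b → w = j ∨ w = u ∨ w = k) : IsHeavy G a b := by
  have hju := hu.lt_left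
  have huk := hu.lt_right
  obtain ⟨eja, -, -, dj⟩ := hG.adj_of_three hj (hG.not_two_two u j hu.adj_left hu.degree_eq)
  obtain ⟨-, -, ekb, dk⟩ := hG.adj_of_three hk (hG.not_two_two u k hu.adj_right hu.degree_eq)
  have hun : ∀ w, G.Adj u w → w = j ∨ w = k := by
    classical
    have hs : ({j, k} : Finset V) ⊆ G.neighborFinset u := by
      intro w hw
      rw [SimpleGraph.mem_neighborFinset]
      rcases Finset.mem_insert.1 hw with rfl | hw
      · exact hu.adj_left
      · rw [Finset.mem_singleton.1 hw]; exact hu.adj_right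
    have hs := Finset.eq_of_subset_of_card_le hs (by
      rw [G.card_neighborFinset_eq_degree, hu.degree_eq, Finset.card_pair (hju.trans huk).ne])
    intro w hw
    rw [← SimpleGraph.mem_neighborFinset, ← hs] at hw
    simpa using hw
  refine ⟨?_, ?_, ⟨j, k, fun w h1 h2 h3 => ?_⟩, ⟨j, k, fun w h1 h2 h3 => ?_⟩⟩
  · by_contra! h
    refine hG.not_G7 ⟨b, a, u, k, j, ?_, ekb.symm, hu.adj_right.symm, hu.adj_left, eja,
      hjb.symm, hak.symm, hu.degree_eq, dk, dj, h⟩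
    simp only [List.nodup_cons, List.mem_cons, List.not_mem_nil, or_false, not_or, List.nodup_nil,
      not_false_eq_true, and_true]
    and_intros <;> order
  · by_contra! h
    refine hG.not_G7 ⟨a, b, u, j, k, ?_, eja.symm, hu.adj_left.symm, hu.adj_right, ekb,
      hak, hjb, hu.degree_eq, dj, dk, h⟩
    simp only [List.nodup_cons, List.mem_cons, List.not_mem_nil, or_false, not_or, List.nodup_nil,
      not_false_eq_true, and_true]
    and_intros <;> order
  · have := hin w h1 h2
    have := hun a
    have := h3.symm
    grind
  · have := hin w h1 h2
    have := hun b
    have := h3.symm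
    grind

/-- The configurations in which one outer side of a crossing is a path of length two. -/
theorem Avoids.not_crossing_of_path_left (hG : Avoids G) (hnd : [a, j, k, b].Nodup)
    (hak : G.Adj a k) (hjb : G.Adj j b) {z : V} (hz : z ∉ [a, j, k, b]) (hza : G.Adj z a)
    (hzj : G.Adj z j) (dz : G.degree z = 2) (hj : ∀ w, G.Adj j w → w = z ∨ w = k ∨ w = b)
    (hk : ∀ w, G.Adj k w → w = a ∨ w = j ∨ w = b) : False := by
  obtain ⟨-, ejk, -, dj⟩ := hG.adj_of_three hj (hG.not_two_two z j hzj dz)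
  by_cases dk : G.degree k = 2
  · exact hG.not_G3 ⟨a, j, z, k, by grind, hza, hzj, hak.symm, ejk.symm, dz, dk, by omega⟩
  · obtain ⟨-, -, ekb, dk⟩ := hG.adj_of_three hk dk
    exact hG.not_G8 ⟨b, a, j, k, z, by grind, ekb.symm, ejk.symm, hzj.symm, hza, hjb.symm,
      hak.symm, dj, dk, dz⟩

/-- The neighbours of degree 2 force degree 3 on `j` and `k`, which gives $G_{10}$. Distinctness
replaces the order so that the mirror image is covered too. -/
theorem Avoids.not_crossing_of_path_left_middle (hG : Avoids G) (hnd : [a, j, k, b].Nodup)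
    (hak : G.Adj a k) (hjb : G.Adj j b) {z u : V} (hz : z ∉ [a, j, k, b]) (hu : u ∉ [a, j, k, b])
    (hzu : z ≠ u) (hza : G.Adj z a) (hzj : G.Adj z j) (dz : G.degree z = 2) (huj : G.Adj u j)
    (huk : G.Adj u k) (du : G.degree u = 2) (hj : ∀ w, G.Adj j w → w = z ∨ w = u ∨ w = b)
    (hk : ∀ w, G.Adj k w → w = a ∨ w = u ∨ w = b) : False := by
  obtain ⟨-, -, -, dj⟩ := hG.adj_of_three hj (hG.not_two_two z j hzj dz)
  obtain ⟨-, -, ekb, dk⟩ := hG.adj_of_three hk (hG.not_two_two u k huk du)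
  exact hG.not_G10 ⟨b, a, u, k, z, j, by grind, ekb.symm, huk.symm, huj, hzj.symm, hza, hjb.symm,
    hak.symm, du, dz, dk, dj⟩

/-- No piece is heavy, as `j` and `k` have degree at most 7. With both outer pieces empty, `[a, b]`
is heavy; one outer path gives $G_3$, $G_8$ or $G_{10}$, and two give $G_9$ or $G_{11}$, according
to the middle piece. -/
theorem IsClosedInterval.isBasic_of_crossing (hG : Avoids G) (hcl : IsClosedInterval G a b)
    (haj : a < j) (hjk : j < k) (hkb : k < b) (hak : G.Adj a k) (hjb : G.Adj j b)
    (c1 : IsClosedInterval G a j) (c3 : IsClosedInterval G k b)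
    (h1 : IsBasic G a j) (h2 : IsBasic G j k) (h3 : IsBasic G k b) : IsBasic G a b := by
  have hj : ∀ w, G.Adj j w → w = a ∨ (a < w ∧ w < j) ∨ (j < w ∧ w < k) ∨ w = k ∨ w = b :=
    fun w hw => by
      obtain ⟨h3, h4⟩ := hcl haj (hjk.trans hkb) hw
      have := hw.ne
      have := c3 (v := w) (w := j)
      have := lt_trichotomy w j
      have := lt_trichotomy w k
      have := hw.symm
      grind
  have hk : ∀ w, G.Adj k w → w = b ∨ (k < w ∧ w < b) ∨ (j < w ∧ w < k) ∨ w = j ∨ w = a :=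
    fun w hw => by
      obtain ⟨h3, h4⟩ := hcl (haj.trans hjk) hkb hw
      have := hw.ne
      have := c1 (v := w) (w := k)
      have := lt_trichotomy w j
      have := lt_trichotomy w k
      have := hw.symm
      grind
  obtain ⟨q, r, hqr⟩ := h2.atMostTwoBetween.1
  obtain ⟨s, t, hst⟩ := h2.atMostTwoBetween.2
  have djle : ¬7 < G.degree j := by
    obtain ⟨q', r', hqr'⟩ := h1.atMostTwoBetween.2
    -- Three chord ends and two neighbours in each adjacent piece: this count matches the bound 7 in
    -- the configurations.
    have := degree_le_length [a, q', r', q, r, k, b] (fun w hw => by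
      rcases hj w hw with h | ⟨h, h'⟩ | ⟨h, h'⟩ | h | h
      · simp [h]
      · rcases hqr' w h h' hw with h | h <;> simp [h]
      · rcases hqr w h h' hw with h | h <;> simp [h]
      · simp [h]
      · simp [h])
    simp only [List.length_cons, List.length_nil] at this
    omega
  have dkle : ¬7 < G.degree k := by
    obtain ⟨q', r', hqr'⟩ := h3.atMostTwoBetween.1
    have := degree_le_length [b, q', r', s, t, j, a] (fun w hw => by
      rcases hk w hw with h | ⟨h, h'⟩ | ⟨h, h'⟩ | h | h
      · simp [h]
      · rcases hqr' w h h' hw with h | h <;> simp [h]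
      · rcases hst w h h' hw with h | h <;> simp [h]
      · simp [h]
      · simp [h])
    simp only [List.length_cons, List.length_nil] at this
    omega
  have hnd : [a, j, k, b].Nodup := by grind
  -- The reversed list serves the mirrored cases, with the path on the right.
  have hnd' : [b, k, j, a].Nodup := by grind
  rcases h1 with h1 | ⟨z, h1⟩ | h1
  · have hj' : ∀ w, G.Adj j w → w = a ∨ (j < w ∧ w < k) ∨ w = k ∨ w = b := fun w hw => by
      have := hj w hw
      have := h1 w
      grind
    rcases h3 with h3 | ⟨w, h3⟩ | h3
    · have hk' : ∀ w, G.Adj k w → w = b ∨ (j < w ∧ w < k) ∨ w = j ∨ w = a := fun w hw => by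
        have := hk w hw
        have := h3 w
        grind
      rcases h2 with h2 | ⟨u, h2⟩ | h2
      · refine Or.inr (Or.inr (isHeavy_of_crossing_of_empty hG haj hjk hkb hak hjb ?_ ?_ ?_))
        · intro w hw; have := hj' w hw; have := h2 w; grind
        · intro w hw; have := hk' w hw; have := h2 w; grind
        · intro w hw hw'; have := h1 w; have := h2 w; have := h3 w
          have := lt_trichotomy w j; have := lt_trichotomy w k; grind
      · refine Or.inr (Or.inr (isHeavy_of_crossing_of_path_middle hG haj hkb hak hjb h2 ?_ ?_ ?_))
        · intro w hw; have := hj' w hw; have := h2.eq_of_mem w; have := h2.not_adj; grind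
        · intro w hw; have := hk' w hw; have := h2.eq_of_mem w; have := h2.not_adj
          have := hw.symm; grind
        · intro w hw hw'; have := h1 w; have := h2.eq_of_mem w; have := h3 w
          have := lt_trichotomy w j; have := lt_trichotomy w k; grind
      · exact absurd h2.left_degree djle
    · have hk' : ∀ x, G.Adj k x → x = w ∨ (j < x ∧ x < k) ∨ x = j ∨ x = a := fun x hx => by
        have := hk x hx
        have := h3.eq_of_mem x
        have := h3.not_adj
        grind
      have := h3.lt_left
      have := h3.lt_right
      exfalso
      rcases h2 with h2 | ⟨u, h2⟩ | h2
      · refine hG.not_crossing_of_path_left hnd' hjb.symm hak.symm (z := w) (by grind) h3.adj_right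
          h3.adj_left h3.degree_eq ?_ ?_
        · intro w hw; have := hk' w hw; have := h2 w; grind
        · intro w hw; have := hj' w hw; have := h2 w; grind
      · have := h2.lt_left
        have := h2.lt_right
        refine hG.not_crossing_of_path_left_middle hnd' hjb.symm hak.symm (z := w) (u := u)
          (by grind) (by grind) (by grind) h3.adj_right
          h3.adj_left h3.degree_eq h2.adj_right h2.adj_left h2.degree_eq ?_ ?_
        · intro w hw; have := hk' w hw; have := h2.eq_of_mem w; have := h2.not_adj
          have := hw.symm; grind
        · intro w hw; have := hj' w hw; have := h2.eq_of_mem w; have := h2.not_adj; grind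
      · exact absurd h2.left_degree djle
    · exact absurd h3.left_degree dkle
  · have hj' : ∀ w, G.Adj j w → w = z ∨ (j < w ∧ w < k) ∨ w = k ∨ w = b := fun w hw => by
      have := hj w hw
      have := h1.eq_of_mem w
      have := h1.not_adj
      have := hw.symm
      grind
    have := h1.lt_left
    have := h1.lt_right
    exfalso
    rcases h3 with h3 | ⟨w, h3⟩ | h3
    · have hk' : ∀ w, G.Adj k w → w = b ∨ (j < w ∧ w < k) ∨ w = j ∨ w = a := fun w hw => by
        have := hk w hw
        have := h3 w
        grind
      rcases h2 with h2 | ⟨u, h2⟩ | h2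
      · refine hG.not_crossing_of_path_left hnd hak hjb (z := z) (by grind) h1.adj_left
          h1.adj_right h1.degree_eq ?_ ?_
        · intro w hw; have := hj' w hw; have := h2 w; grind
        · intro w hw; have := hk' w hw; have := h2 w; grind
      · have := h2.lt_left
        have := h2.lt_right
        refine hG.not_crossing_of_path_left_middle hnd hak hjb (z := z) (u := u)
          (by grind) (by grind) (by grind) h1.adj_left
          h1.adj_right h1.degree_eq h2.adj_left h2.adj_right h2.degree_eq ?_ ?_
        · intro w hw; have := hj' w hw; have := h2.eq_of_mem w; have := h2.not_adj; grind
        · intro w hw; have := hk' w hw; have := h2.eq_of_mem w; have := h2.not_adj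
          have := hw.symm; grind
      · exact absurd h2.left_degree djle
    · have hk' : ∀ x, G.Adj k x → x = w ∨ (j < x ∧ x < k) ∨ x = j ∨ x = a := fun x hx => by
        have := hk x hx
        have := h3.eq_of_mem x
        have := h3.not_adj
        grind
      have := h3.lt_left
      have := h3.lt_right
      have ndj := hG.not_two_two z j h1.adj_right h1.degree_eq
      have ndk := hG.not_two_two w k h3.adj_left h3.degree_eq
      rcases h2 with h2 | ⟨u, h2⟩ | h2
      · obtain ⟨-, ejk, -, dj⟩ := hG.adj_of_three (v := j) (x := z) (y := k) (z := b)
          (fun w hw => by have := hj' w hw; have := h2 w; grind) ndj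
        obtain ⟨-, -, -, dk⟩ := hG.adj_of_three (v := k) (x := w) (y := j) (z := a)
          (fun w hw => by have := hk' w hw; have := h2 w; grind) ndk
        refine hG.not_G9 ⟨a, b, z, k, j, w, ?_, h1.adj_left.symm, h1.adj_right, ejk,
          h3.adj_left.symm, h3.adj_right, hak, hjb, h1.degree_eq, h3.degree_eq, dk, dj⟩
        simp only [List.nodup_cons, List.mem_cons, List.not_mem_nil, or_false, not_or, List.nodup_nil,
          not_false_eq_true, and_true]
        and_intros <;> order
      · have := h2.lt_left
        have := h2.lt_right
        obtain ⟨-, -, -, dj⟩ := hG.adj_of_three (v := j) (x := z) (y := u) (z := b)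
          (fun w hw => by
            have := hj' w hw; have := h2.eq_of_mem w; have := h2.not_adj; grind) ndj
        obtain ⟨-, -, -, dk⟩ := hG.adj_of_three (v := k) (x := w) (y := u) (z := a)
          (fun w hw => by
            have := hk' w hw; have := h2.eq_of_mem w; have := h2.not_adj
            have := hw.symm; grind) ndk
        refine hG.not_G11 ⟨a, b, u, k, j, z, w, ?_, h1.adj_left.symm, h1.adj_right,
          h2.adj_left.symm, h2.adj_right, h3.adj_left.symm, h3.adj_right, hak, hjb, h2.degree_eq,
          h1.degree_eq, h3.degree_eq, dk, dj⟩
        simp only [List.nodup_cons, List.mem_cons, List.not_mem_nil, or_false, not_or, List.nodup_nil,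
          not_false_eq_true, and_true]
        and_intros <;> order
      · exact absurd h2.left_degree djle
    · exact absurd h3.left_degree dkle
  · exact absurd h1.right_degree djle

theorem IsClosedInterval.isBasic (hG : Avoids G) (hcr : AtMostOneCrossing G) :
    ∀ (n : ℕ) (a b : V), (Finset.univ.filter fun v => a ≤ v ∧ v ≤ b).card = n →
      a < b → IsClosedInterval G a b → IsBasic G a b := by
  intro n
  induction n using Nat.strong_induction_on with
  | _ n ih =>
  intro a b hn hab hcl
  have ih' : ∀ c d, a ≤ c → d ≤ b → (a < c ∨ d < b) → c < d → IsClosedInterval G c d →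
      IsBasic G c d := fun c d hac hdb h hcd hcd' => by
    refine ih _ ?_ c d rfl hcd hcd'
    rw [← hn]
    refine Finset.card_lt_card (Finset.ssubset_iff_of_subset (fun v hv => ?_) |>.2 ?_)
    · simp only [Finset.mem_filter, Finset.mem_univ, true_and] at hv ⊢
      exact ⟨hac.trans hv.1, hv.2.trans hdb⟩
    · simp only [Finset.mem_filter, Finset.mem_univ, true_and]
      rcases h with h | h
      · exact ⟨a, ⟨le_rfl, hab.le⟩, fun h' => absurd h'.1 (not_le.2 h)⟩
      · exact ⟨b, ⟨hab.le, le_rfl⟩, fun h' => absurd h'.2 (not_le.2 h)⟩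
  by_cases hne : ∃ v, a < v ∧ v < b
  · rcases hcr.uncovered_or_crossing hne with ⟨p, hap, hpb, hp⟩ | ⟨j, k, haj, hjk, hkb, hak, hjb⟩
    · obtain ⟨c1, c2⟩ := hcl.of_uncovered hap hpb hp
      exact hcl.isBasic_of_uncovered hG hap hpb (ih' a p le_rfl hpb.le (Or.inr hpb) hap c1)
        (ih' p b hap.le le_rfl (Or.inl hap) hpb c2)
    · obtain ⟨c1, c2, c3⟩ := hcl.of_crossing hcr haj hjk hkb hak hjb
      have hjb' := hjk.trans hkb
      have hak' := haj.trans hjk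
      exact hcl.isBasic_of_crossing hG haj hjk hkb hak hjb c1 c3
        (ih' a j le_rfl hjb'.le (Or.inr hjb') haj c1)
        (ih' j k haj.le hkb.le (Or.inl haj) hjk c2)
        (ih' k b hak'.le le_rfl (Or.inl hak') hkb c3)
  · exact Or.inl fun v h1 h2 => hne ⟨v, h1, h2⟩

theorem AtMostOneCrossing.not_avoids [Nonempty V] (hcr : AtMostOneCrossing G) : ¬Avoids G := by
  intro hG
  obtain ⟨a, ha⟩ := Finite.exists_min (id : V → V)
  obtain ⟨b, hb⟩ := Finite.exists_max (id : V → V)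
  simp only [id] at ha hb
  have h2 := hG.two_le_degree a
  rcases (ha b).eq_or_lt with rfl | hab
  · have := degree_le_length (G := G) (v := a) [] (fun w hw => absurd hw.ne (by simpa using (ha w).antisymm (hb w)))
    simp only [List.length_nil] at this
    omega
  have hbasic := IsClosedInterval.isBasic hG hcr _ a b rfl hab fun v w _ _ _ => ⟨ha w, hb w⟩
  have hnb : ∀ w, G.Adj a w → w ≠ b → a < w ∧ w < b := fun w hw h =>
    ⟨(ha w).lt_of_ne hw.ne, (hb w).lt_of_ne h⟩
  rcases hbasic with h | ⟨u, h⟩ | h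
  · have := degree_le_length (G := G) (v := a) [b] (fun w hw => by
      have := hnb w hw; have := eq_or_ne w b; have := h w; grind)
    simp only [List.length_cons, List.length_nil] at this
    omega
  · have := degree_le_length (G := G) (v := a) [u] (fun w hw => by
      have := hnb w hw; have := eq_or_ne w b; have := h.eq_of_mem w; have := h.not_adj; grind)
    simp only [List.length_cons, List.length_nil] at this
    omega
  · obtain ⟨p, q, hpq⟩ := h.left_two
    have := degree_le_length (G := G) (v := a) [b, p, q] (fun w hw => by
      have := hnb w hw; have := eq_or_ne w b; have := hpq w; grind)
    simp only [List.length_cons, List.length_nil] at this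
    have := h.left_degree
    omega

end Structure

theorem corollary2p6 {V : Type*} [Fintype V] [Nonempty V] (G : SimpleGraph V)
    [DecidableRel G.Adj] (hG : IsOuterOnePlanar G) :
    (∃ v, G.degree v ≤ 1) ∨
    (∃ u v, G.Adj u v ∧ G.degree u = 2 ∧ G.degree v = 2) ∨
    (∃ u x y, G.Adj u x ∧ G.Adj u y ∧ G.Adj x y ∧ G.degree u = 2) ∨
    ContainsG3 G ∨ ContainsG6 G ∨ ContainsG7 G ∨ ContainsG8 G ∨ ContainsG9 G ∨
    ContainsG10 G ∨ ContainsG11 G := by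
  obtain ⟨_, hcr⟩ := hG.exists_linearOrder
  by_contra h
  simp only [not_or] at h
  obtain ⟨h1, h2, h3, h4, h5, h6, h7, h8, h9, h10⟩ := h
  refine hcr.not_avoids ⟨fun v => ?_, fun u v e du dv => h2 ⟨u, v, e, du, dv⟩,
    fun u x y e1 e2 e3 du => h3 ⟨u, x, y, e1, e2, e3, du⟩, h4, h5, h6, h7, h8, h9, h10⟩
  by_contra hv
  exact h1 ⟨v, by omega⟩
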